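/- All graphs are finite and simple. A graph $G$ is a cograph if it can be obtained from one-vertex graphs by repeatedly taking the disjoint union of two vertex-disjoint graphs, or their complete join (the disjoint union together with all edges between the two vertex sets). Equivalently phrased, $G$ has a cotree: a rooted binary tree whose leaves are the vertices of $G$, whose internal nodes each have two children and are marked as union or join nodes, and whose root represents $G$ under these operations. For a graph $G$ and an integer $k$, let $\mathrm{TJ}_k(G)$ be the graph whose vertices are the independent sets of $G$ of size exactly $k$, where two distinct independent sets $I$ and $J$ are adjacent if there are vertices $u\in I$ and $v\in J$ with $I\setminus\{u\}=J\setminus\{v\}$. Let $G$ be a cograph on $n$ vertices and let $k$ be an integer. Then every connected component of $\mathrm{TJ}_k(G)$ has (finite) diameter at most $2n-k$. -/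

import Mathlib

/-- A binary tree whose internal nodes are marked as union nodes or join nodes (with a left and a
right child) and whose leaves carry a single vertex of `V`. -/
inductive Cotree (V : Type*) where
  | leaf (v : V) : Cotree V
  | union (l r : Cotree V) : Cotree V
  | join (l r : Cotree V) : Cotree V

namespace Cotree

variable {V : Type*}

/-- The vertex set of the graph of the root of the tree. -/
def verts : Cotree V → Set V
  | leaf v => {v}
  | union l r => l.verts ∪ r.verts
  | join l r => l.verts ∪ r.verts

/-- Different leaves carry different vertices: at every internal node, the graphs of the two
children are vertex disjoint. -/
def Valid : Cotree V → Prop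
  | leaf _ => True
  | union l r => l.Valid ∧ r.Valid ∧ Disjoint l.verts r.verts
  | join l r => l.Valid ∧ r.Valid ∧ Disjoint l.verts r.verts

/-- Adjacency in the graph of the root of the tree: a leaf has no edges, a union node has the edges
of its two children, and a join node has in addition all edges between the vertices of its left
child and the vertices of its right child. -/
def Adj : Cotree V → V → V → Prop
  | leaf _, _, _ => False
  | union l r, x, y => l.Adj x y ∨ r.Adj x y
  | join l r, x, y => l.Adj x y ∨ r.Adj x y ∨
      (x ∈ l.verts ∧ y ∈ r.verts) ∨ (x ∈ r.verts ∧ y ∈ l.verts)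

/-- `T` is a cotree for `G`: the graph of the root of `T` is `G`. -/
def IsCotreeFor (T : Cotree V) (G : SimpleGraph V) : Prop :=
  T.Valid ∧ T.verts = Set.univ ∧ ∀ x y, G.Adj x y ↔ T.Adj x y

end Cotree

/-- A cograph is a graph that has a cotree. -/
def IsCograph {V : Type*} (G : SimpleGraph V) : Prop :=
  ∃ T : Cotree V, T.IsCotreeFor G

/-- The token jumping graph `TJ_k(G)`: its vertices are the independent sets of `G` of size exactly
`k`, and two distinct ones `I`, `J` are adjacent if `I \ {u} = J \ {v}` for some `u ∈ I`,
`v ∈ J`. -/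
def tokenJumpingGraph {V : Type*} [DecidableEq V] (G : SimpleGraph V) (k : ℤ) :
    SimpleGraph {I : Finset V // G.IsIndepSet (I : Set V) ∧ (I.card : ℤ) = k} where
  Adj I J := I ≠ J ∧ ∃ u ∈ I.1, ∃ v ∈ J.1, I.1 \ {u} = J.1 \ {v}
  symm := ⟨fun _ _ ⟨hne, u, hu, v, hv, h⟩ => ⟨hne.symm, v, hv, u, hu, h.symm⟩⟩
  loopless := ⟨fun _ h => h.1 rfl⟩

/-! Replace jumps by single additions and removals among independent sets of size at least k - 1
(`tokenAddRemGraph`). One jump corresponds to two such moves, so it suffices to join I to J there by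
a walk of length at most 4n - 2k.

From either set, head for a normal form. Whenever a cotree node has level at most 0, so that it can
be emptied without dropping below the threshold, replace its tokens by its canonical maximum
independent set. This stops at a `Terminal` set. Bookkeeping with `Settled` vertices shows that
vertices of I are never added again and all others are added at most once, so at most |I| + 2(n -
|I|) = 2n - k moves are spent (`exists_walk_terminal`).

The normal form is unique within a component. `Confined` is invariant under moves and bounds token
counts by those of the terminal set. Two mutually reachable terminal sets therefore have equal
counts, hence equal levels, in the children of a union node of positive level, and they agree by
induction (`Terminal.inter_eq_inter`). Joining the two walks gives 4n - 2k moves, which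
`exists_tokenJumpingGraph_walk_of_walk` turns into half as many jumps. -/

namespace Cotree

/-! ### Independent sets along a cotree -/

variable {V : Type*}

/-- No two elements of `I` are adjacent in the graph of the root of the tree. -/
def Indep (T : Cotree V) (I : Finset V) : Prop := ∀ x ∈ I, ∀ y ∈ I, ¬ T.Adj x y

theorem Indep.of_union {l r : Cotree V} {I : Finset V} (h : (union l r).Indep I) :
    l.Indep I ∧ r.Indep I :=
  ⟨fun x hx y hy ha => h x hx y hy (Or.inl ha), fun x hx y hy ha => h x hx y hy (Or.inr ha)⟩

theorem Indep.of_join {l r : Cotree V} {I : Finset V} (h : (join l r).Indep I) :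
    l.Indep I ∧ r.Indep I :=
  ⟨fun x hx y hy ha => h x hx y hy (Or.inl ha),
    fun x hx y hy ha => h x hx y hy (Or.inr (Or.inl ha))⟩

theorem indep_union {l r : Cotree V} {I : Finset V} (hl : l.Indep I) (hr : r.Indep I) :
    (union l r).Indep I :=
  fun x hx y hy ha => ha.elim (hl x hx y hy) (hr x hx y hy)

theorem IsCotreeFor.indep_iff {T : Cotree V} {G : SimpleGraph V} (h : T.IsCotreeFor G)
    (I : Finset V) : T.Indep I ↔ G.IsIndepSet (I : Set V) := by
  constructor
  · intro hI x hx y hy _ ha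
    exact hI x hx y hy ((h.2.2 x y).1 ha)
  · intro hI x hx y hy ha
    have ha := (h.2.2 x y).2 ha
    exact hI hx hy ha.ne ha

variable [DecidableEq V]

theorem notMem_of_inter_eq_empty {I A : Finset V} (h : I ∩ A = ∅) {x : V} (hA : x ∈ A) : x ∉ I :=
  fun hI => Finset.notMem_empty x (h ▸ Finset.mem_inter.2 ⟨hI, hA⟩)

/-- The vertex set of the root of the tree, as a finset. -/
def support : Cotree V → Finset V
  | leaf v => {v}
  | union l r => l.support ∪ r.support
  | join l r => l.support ∪ r.support

/-- A canonical maximum independent set. -/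
def maxIndep : Cotree V → Finset V
  | leaf v => {v}
  | union l r => l.maxIndep ∪ r.maxIndep
  | join l r => if r.maxIndep.card ≤ l.maxIndep.card then l.maxIndep else r.maxIndep

theorem coe_support (T : Cotree V) : (T.support : Set V) = T.verts := by
  induction T <;> simp_all [support, verts]

theorem mem_verts {T : Cotree V} {x : V} : x ∈ T.verts ↔ x ∈ T.support := by
  rw [← coe_support, Finset.mem_coe]

theorem Adj.mem {T : Cotree V} {x y : V} (h : T.Adj x y) : x ∈ T.support ∧ y ∈ T.support := by
  induction T with
  | leaf v => exact h.elim
  | union l r ihl ihr => simp only [Adj, support, Finset.mem_union] at *; grind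
  | join l r ihl ihr => simp only [Adj, support, Finset.mem_union, mem_verts] at *; grind

theorem maxIndep_subset (T : Cotree V) : T.maxIndep ⊆ T.support := by
  induction T with
  | leaf v => exact subset_rfl
  | union l r ihl ihr => exact Finset.union_subset_union ihl ihr
  | join l r ihl ihr => simp only [maxIndep, support]; grind

theorem disjoint_support {l r : Cotree V} (h : Disjoint l.verts r.verts) :
    Disjoint l.support r.support := by
  rwa [← Finset.disjoint_coe, coe_support, coe_support]

theorem Indep.inter_eq_empty {l r : Cotree V} {I : Finset V} (h : (join l r).Indep I) :
    I ∩ l.support = ∅ ∨ I ∩ r.support = ∅ := by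
  by_contra! hc
  obtain ⟨⟨x, hx⟩, y, hy⟩ := hc
  rw [Finset.mem_inter, ← mem_verts] at hx hy
  exact h x hx.1 y hy.1 (Or.inr (Or.inr (Or.inl ⟨hx.2, hy.2⟩)))

theorem indep_join_left {l r : Cotree V} {I : Finset V} (h : I ∩ r.support = ∅)
    (hI : l.Indep I) : (join l r).Indep I := by
  intro x hx y hy ha
  rcases ha with ha | ha | ha | ha
  · exact hI x hx y hy ha
  · exact notMem_of_inter_eq_empty h ha.mem.1 hx
  · exact notMem_of_inter_eq_empty h (mem_verts.1 ha.2) hy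
  · exact notMem_of_inter_eq_empty h (mem_verts.1 ha.1) hx

theorem indep_join_right {l r : Cotree V} {I : Finset V} (h : I ∩ l.support = ∅)
    (hI : r.Indep I) : (join l r).Indep I := by
  intro x hx y hy ha
  rcases ha with ha | ha | ha | ha
  · exact notMem_of_inter_eq_empty h ha.mem.1 hx
  · exact hI x hx y hy ha
  · exact notMem_of_inter_eq_empty h (mem_verts.1 ha.1) hx
  · exact notMem_of_inter_eq_empty h (mem_verts.1 ha.2) hy

theorem card_inter_union {A B : Finset V} (h : Disjoint A B) (I : Finset V) :
    (I ∩ (A ∪ B)).card = (I ∩ A).card + (I ∩ B).card := by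
  rw [Finset.inter_union_distrib_left, Finset.card_union_of_disjoint]
  exact h.mono Finset.inter_subset_right Finset.inter_subset_right

theorem maxIndep_inter_union {l r : Cotree V} (h : Disjoint l.support r.support) {I : Finset V}
    (hI : I ∩ (union l r).support = (union l r).maxIndep) :
    I ∩ l.support = l.maxIndep ∧ I ∩ r.support = r.maxIndep := by
  have h1 := l.maxIndep_subset
  have h2 := r.maxIndep_subset
  simp only [support, maxIndep] at hI
  rw [Finset.disjoint_left] at h
  constructor <;> ext x <;> have := Finset.ext_iff.1 hI x <;> grind

theorem maxIndep_inter_join {l r : Cotree V} (h : Disjoint l.support r.support) {I : Finset V}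
    (hI : I ∩ (join l r).support = (join l r).maxIndep) :
    (I ∩ l.support = l.maxIndep ∧ I ∩ r.support = ∅) ∨
      (I ∩ r.support = r.maxIndep ∧ I ∩ l.support = ∅) := by
  have h1 := l.maxIndep_subset
  have h2 := r.maxIndep_subset
  simp only [support, maxIndep] at hI
  rw [Finset.disjoint_left] at h
  split_ifs at hI
  · left
    constructor <;> ext x <;> have := Finset.ext_iff.1 hI x <;> grind
  · right
    constructor <;> ext x <;> have := Finset.ext_iff.1 hI x <;> grind

theorem indep_maxIndep {T : Cotree V} (hT : T.Valid) {I : Finset V}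
    (hI : I ∩ T.support = T.maxIndep) : T.Indep I := by
  induction T with
  | leaf v => exact fun x _ y _ h => h
  | union l r ihl ihr =>
    obtain ⟨h1, h2⟩ := maxIndep_inter_union (disjoint_support hT.2.2) hI
    exact indep_union (ihl hT.1 h1) (ihr hT.2.1 h2)
  | join l r ihl ihr =>
    rcases maxIndep_inter_join (disjoint_support hT.2.2) hI with ⟨h1, h2⟩ | ⟨h1, h2⟩
    · exact indep_join_left h2 (ihl hT.1 h1)
    · exact indep_join_right h2 (ihr hT.2.1 h1)

theorem card_le_maxIndep {T : Cotree V} (hT : T.Valid) {L : Finset V} (hL : T.Indep L) :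
    (L ∩ T.support).card ≤ T.maxIndep.card := by
  induction T with
  | leaf v => exact Finset.card_le_card Finset.inter_subset_right
  | union l r ihl ihr =>
    have hd := disjoint_support hT.2.2
    have h1 := ihl hT.1 hL.of_union.1
    have h2 := ihr hT.2.1 hL.of_union.2
    rw [support, card_inter_union hd, maxIndep, Finset.card_union_of_disjoint
      (hd.mono l.maxIndep_subset r.maxIndep_subset)]
    omega
  | join l r ihl ihr =>
    have hd := disjoint_support hT.2.2
    have h1 := ihl hT.1 hL.of_join.1
    have h2 := ihr hT.2.1 hL.of_join.2
    rw [support, card_inter_union hd, maxIndep]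
    rcases hL.inter_eq_empty with h | h <;> rw [h, Finset.card_empty] <;> split_ifs <;> omega

/-! ### Terminal sets and their uniqueness within a component -/

/-- `I` cannot be improved at level `k`: wherever the level of a node of the tree is at most `0`,
`I` restricts to the canonical maximum independent set. The level of a child of a union node is
lowered by the number of elements of `I` in the other child. -/
def Terminal : Cotree V → ℤ → Finset V → Prop
  | leaf v, k, I => k ≤ 0 → I ∩ {v} = {v}
  | union l r, k, I => (k ≤ 0 → I ∩ (union l r).support = (union l r).maxIndep) ∧
      (0 < k → l.Terminal (k - (I ∩ r.support).card) I ∧ r.Terminal (k - (I ∩ l.support).card) I)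
  | join l r, k, I => (k ≤ 0 → I ∩ (join l r).support = (join l r).maxIndep) ∧
      (0 < k → (I ∩ r.support = ∅ ∧ l.Terminal k I) ∨ (I ∩ l.support = ∅ ∧ r.Terminal k I))

theorem Terminal.inter_eq {T : Cotree V} {k : ℤ} {I : Finset V} (h : T.Terminal k I)
    (hk : k ≤ 0) : I ∩ T.support = T.maxIndep := by
  cases T with
  | leaf v => exact h hk
  | union l r => exact h.1 hk
  | join l r => exact h.1 hk

theorem terminal_of_inter_eq {T : Cotree V} (hT : T.Valid) (k : ℤ) {I : Finset V}
    (hI : I ∩ T.support = T.maxIndep) : T.Terminal k I := by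
  induction T generalizing k with
  | leaf v => exact fun _ => hI
  | union l r ihl ihr =>
    obtain ⟨h1, h2⟩ := maxIndep_inter_union (disjoint_support hT.2.2) hI
    exact ⟨fun _ => hI, fun _ => ⟨ihl hT.1 _ h1, ihr hT.2.1 _ h2⟩⟩
  | join l r ihl ihr =>
    refine ⟨fun _ => hI, fun _ => ?_⟩
    rcases maxIndep_inter_join (disjoint_support hT.2.2) hI with ⟨h1, h2⟩ | ⟨h1, h2⟩
    · exact Or.inl ⟨h2, ihl hT.1 _ h1⟩
    · exact Or.inr ⟨h2, ihr hT.2.1 _ h1⟩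

/-- An upper bound for the independent sets `L` that are reachable from the terminal set `M`. -/
def Confined : Cotree V → ℤ → Finset V → Finset V → Prop
  | leaf _, _, _, _ => True
  | union l r, k, M, L => 0 < k →
      l.Confined (k - (M ∩ r.support).card) M L ∧ r.Confined (k - (M ∩ l.support).card) M L
  | join l r, k, M, L => 0 < k →
      (M ∩ r.support = ∅ ∧ L ∩ r.support = ∅ ∧ l.Confined k M L) ∨
      (M ∩ l.support = ∅ ∧ L ∩ l.support = ∅ ∧ r.Confined k M L)

theorem Terminal.confined_self {T : Cotree V} {k : ℤ} {M : Finset V} (h : T.Terminal k M) :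
    T.Confined k M M := by
  induction T generalizing k with
  | leaf v => trivial
  | union l r ihl ihr => exact fun hk => ⟨ihl (h.2 hk).1, ihr (h.2 hk).2⟩
  | join l r ihl ihr =>
    exact fun hk => (h.2 hk).imp (fun h => ⟨h.1, h.1, ihl h.2⟩) (fun h => ⟨h.1, h.1, ihr h.2⟩)

/-- At level at most 0, M is already maximum on the node. At positive level, the bounds for the
children of a union node add up; at a join node M is nonempty, so both sets live in the same child.
-/
theorem Confined.card_le {T : Cotree V} (hT : T.Valid) {k : ℤ} {M L : Finset V}
    (hM : T.Terminal k M) (hkM : k ≤ (M ∩ T.support).card) (hL : T.Indep L)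
    (h : T.Confined k M L) : (L ∩ T.support).card ≤ (M ∩ T.support).card := by
  induction T generalizing k with
  | leaf v =>
    rcases le_or_gt k 0 with hk | hk
    · rw [hM.inter_eq hk]
      exact card_le_maxIndep hT hL
    have : (L ∩ (leaf v).support).card ≤ 1 :=
      Finset.card_le_card (Finset.inter_subset_right (s₂ := {v}))
    omega
  | union l r ihl ihr =>
    rcases le_or_gt k 0 with hk | hk
    · rw [hM.inter_eq hk]
      exact card_le_maxIndep hT hL
    have hd := disjoint_support hT.2.2
    rw [support, card_inter_union hd] at *
    rw [card_inter_union hd]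
    push_cast at hkM
    have h1 := ihl hT.1 (hM.2 hk).1 (by omega) hL.of_union.1 (h hk).1
    have h2 := ihr hT.2.1 (hM.2 hk).2 (by omega) hL.of_union.2 (h hk).2
    omega
  | join l r ihl ihr =>
    rcases le_or_gt k 0 with hk | hk
    · rw [hM.inter_eq hk]
      exact card_le_maxIndep hT hL
    have hd := disjoint_support hT.2.2
    rw [support, card_inter_union hd] at *
    rw [card_inter_union hd]
    push_cast at hkM
    rcases h hk with ⟨h1, h2, h3⟩ | ⟨h1, h2, h3⟩ <;>
    rcases hM.2 hk with ⟨h4, h5⟩ | ⟨h4, h5⟩ <;>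
    simp only [h1, h2, h4, Finset.card_empty] at hkM ⊢
    · have := ihl hT.1 h5 (by omega) hL.of_join.1 h3
      omega
    · omega
    · omega
    · have := ihr hT.2.1 h5 (by omega) hL.of_join.2 h3
      omega

/-- At a union node `Confined.card_le` caps the tokens in one child, so the other child keeps at
least its level and the induction can descend. At a join node of positive level, one change cannot
carry a nonempty set to the other side. -/
theorem Confined.step {T : Cotree V} (hT : T.Valid) {k : ℤ} {M L L' : Finset V}
    (hM : T.Terminal k M) (hkM : k ≤ (M ∩ T.support).card)
    (hL : T.Indep L) (hL' : T.Indep L')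
    (hkL : k ≤ (L ∩ T.support).card) (hkL' : k ≤ (L' ∩ T.support).card)
    (h : T.Confined k M L) {x : V} (hx : ∀ y, y ≠ x → (y ∈ L ↔ y ∈ L')) :
    T.Confined k M L' := by
  have aux (A : Finset V) (hA : x ∉ A) : L' ∩ A = L ∩ A := by
    ext y
    have := hx y
    grind
  induction T generalizing k with
  | leaf v => trivial
  | union l r ihl ihr =>
    intro hk
    have hd := disjoint_support hT.2.2
    rw [support, card_inter_union hd] at *
    push_cast at *
    have h1 := Confined.card_le hT.1 (hM.2 hk).1 (by omega) hL.of_union.1 (h hk).1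
    have h2 := Confined.card_le hT.2.1 (hM.2 hk).2 (by omega) hL.of_union.2 (h hk).2
    -- The vertex x lies in at most one child; the count in the other carries over from L to L'.
    have h3 : (L' ∩ l.support).card = (L ∩ l.support).card ∨
        (L' ∩ r.support).card = (L ∩ r.support).card := by
      by_cases hxl : x ∈ l.support
      · right; rw [aux _ (Finset.disjoint_left.1 hd hxl)]
      · left; rw [aux _ hxl]
    exact ⟨ihl hT.1 (hM.2 hk).1 (by omega) hL.of_union.1 hL'.of_union.1 (by omega) (by omega)
      (h hk).1, ihr hT.2.1 (hM.2 hk).2 (by omega) hL.of_union.2 hL'.of_union.2 (by omega)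
      (by omega) (h hk).2⟩
  | join l r ihl ihr =>
    intro hk
    have hd := disjoint_support hT.2.2
    rw [support, card_inter_union hd] at *
    push_cast at *
    have h0 : L' ∩ l.support = ∅ ∨ L' ∩ r.support = ∅ := hL'.inter_eq_empty
    have h3 : L' ∩ l.support = L ∩ l.support ∨ L' ∩ r.support = L ∩ r.support := by
      by_cases hxl : x ∈ l.support
      · right; rw [aux _ (Finset.disjoint_left.1 hd hxl)]
      · left; rw [aux _ hxl]
    rcases h hk with ⟨h1, h2, h4⟩ | ⟨h1, h2, h4⟩ <;>
    rcases hM.2 hk with ⟨h5, h6⟩ | ⟨h5, h6⟩ <;>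
    simp only [h1, h2, h5, Finset.card_empty] at hkM hkL
    · have h7 : L' ∩ r.support = ∅ := by
        rcases h0 with h0 | h0
        · rcases h3 with h3 | h3
          · rw [← h3, h0] at hkL
            simp only [Finset.card_empty] at hkL
            omega
          · rw [h3, h2]
        · exact h0
      rw [h7, Finset.card_empty] at hkL'
      exact Or.inl ⟨h5, h7, ihl hT.1 h6 (by omega) hL.of_join.1 hL'.of_join.1 (by omega) (by omega)
        h4⟩
    · omega
    · omega
    · have h7 : L' ∩ l.support = ∅ := by
        rcases h0 with h0 | h0
        · exact h0
        · rcases h3 with h3 | h3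
          · rw [h3, h2]
          · rw [← h3, h0] at hkL
            simp only [Finset.card_empty] at hkL
            omega
      rw [h7, Finset.card_empty] at hkL'
      exact Or.inr ⟨h5, h7, ihr hT.2.1 h6 (by omega) hL.of_join.2 hL'.of_join.2 (by omega)
        (by omega) h4⟩

theorem Terminal.inter_eq_inter {T : Cotree V} (hT : T.Valid) {k : ℤ} {M N : Finset V}
    (hM : T.Terminal k M) (hN : T.Terminal k N) (hkM : k ≤ (M ∩ T.support).card)
    (hkN : k ≤ (N ∩ T.support).card) (hMi : T.Indep M) (hNi : T.Indep N)
    (h : T.Confined k M N) (h' : T.Confined k N M) : M ∩ T.support = N ∩ T.support := by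
  rcases le_or_gt k 0 with hk | hk
  · rw [hM.inter_eq hk, hN.inter_eq hk]
  induction T generalizing k with
  | leaf v =>
    have aux (L : Finset V) (hL : k ≤ (L ∩ (leaf v).support).card) :
        L ∩ (leaf v).support = {v} := by
      refine Finset.eq_of_subset_of_card_le Finset.inter_subset_right ?_
      rw [Finset.card_singleton]
      omega
    rw [aux M hkM, aux N hkN]
  | union l r ihl ihr =>
    have hd := disjoint_support hT.2.2
    rw [support, card_inter_union hd] at *
    push_cast at *
    have h1 := Confined.card_le hT.1 (hM.2 hk).1 (by omega) hNi.of_union.1 (h hk).1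
    have h2 := Confined.card_le hT.2.1 (hM.2 hk).2 (by omega) hNi.of_union.2 (h hk).2
    have h3 := Confined.card_le hT.1 (hN.2 hk).1 (by omega) hMi.of_union.1 (h' hk).1
    have h4 := Confined.card_le hT.2.1 (hN.2 hk).2 (by omega) hMi.of_union.2 (h' hk).2
    have e1 := le_antisymm h1 h3
    have e2 := le_antisymm h2 h4
    obtain ⟨m1, m2⟩ := hM.2 hk
    obtain ⟨n1, n2⟩ := hN.2 hk
    obtain ⟨c1, c2⟩ := h hk
    obtain ⟨d1, d2⟩ := h' hk
    -- Equal counts make the levels of each child the same for M and N, as the induction hypothesis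
    -- requires.
    rw [e2] at n1 d1
    rw [e1] at n2 d2
    have f1 : M ∩ l.support = N ∩ l.support := by
      rcases le_or_gt (k - (M ∩ r.support).card) 0 with hk' | hk'
      · rw [m1.inter_eq hk', n1.inter_eq hk']
      · exact ihl hT.1 m1 n1 (by omega) (by omega) hMi.of_union.1 hNi.of_union.1 c1 d1 hk'
    have f2 : M ∩ r.support = N ∩ r.support := by
      rcases le_or_gt (k - (M ∩ l.support).card) 0 with hk' | hk'
      · rw [m2.inter_eq hk', n2.inter_eq hk']
      · exact ihr hT.2.1 m2 n2 (by omega) (by omega) hMi.of_union.2 hNi.of_union.2 c2 d2 hk'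
    rw [Finset.inter_union_distrib_left, Finset.inter_union_distrib_left, f1, f2]
  | join l r ihl ihr =>
    have hd := disjoint_support hT.2.2
    rw [support, card_inter_union hd] at *
    push_cast at *
    rw [Finset.inter_union_distrib_left, Finset.inter_union_distrib_left]
    have key : (M ∩ r.support = ∅ ∧ N ∩ r.support = ∅) ∨
        (M ∩ l.support = ∅ ∧ N ∩ l.support = ∅) :=
      (h hk).imp (fun h => ⟨h.1, h.2.1⟩) (fun h => ⟨h.1, h.2.1⟩)
    rcases key with ⟨h1, h2⟩ | ⟨h1, h2⟩ <;>
    simp only [h1, h2, Finset.card_empty] at hkM hkN ⊢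
    · have hMl : M ∩ l.support ≠ ∅ := by
        intro e
        rw [e, Finset.card_empty] at hkM
        omega
      have hNl : N ∩ l.support ≠ ∅ := by
        intro e
        rw [e, Finset.card_empty] at hkN
        omega
      rw [ihl hT.1 ((hM.2 hk).resolve_right fun h => hMl h.1).2
        ((hN.2 hk).resolve_right fun h => hNl h.1).2 (by omega) (by omega) hMi.of_join.1
        hNi.of_join.1 ((h hk).resolve_right fun h => hMl h.1).2.2
        ((h' hk).resolve_right fun h => hNl h.1).2.2 hk]
    · have hMr : M ∩ r.support ≠ ∅ := by
        intro e
        rw [e, Finset.card_empty] at hkM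
        omega
      have hNr : N ∩ r.support ≠ ∅ := by
        intro e
        rw [e, Finset.card_empty] at hkN
        omega
      rw [ihr hT.2.1 ((hM.2 hk).resolve_left fun h => hMr h.1).2
        ((hN.2 hk).resolve_left fun h => hNr h.1).2 (by omega) (by omega) hMi.of_join.2
        hNi.of_join.2 ((h hk).resolve_left fun h => hMr h.1).2.2
        ((h' hk).resolve_left fun h => hNr h.1).2.2 hk]

/-! ### Settled vertices and improvement steps -/

/-- `D` is a set of vertices that have reached their final state, up to removals: around each of
them `I` restricts to a canonical maximum independent set. -/
def Settled : Cotree V → Finset V → Finset V → Prop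
  | leaf v, I, D => v ∈ D → v ∈ I
  | union l r, I, D => l.Settled I D ∧ r.Settled I D
  | join l r, I, D => I ∩ (join l r).support = (join l r).maxIndep ∨
      (I ∩ r.support = ∅ ∧ D ∩ r.support = ∅ ∧ l.Settled I D) ∨
      (I ∩ l.support = ∅ ∧ D ∩ l.support = ∅ ∧ r.Settled I D)

theorem Settled.congr {T : Cotree V} {I I' D D' : Finset V} (h : T.Settled I D)
    (hI : ∀ x ∈ T.support, x ∈ I' ↔ x ∈ I) (hD : ∀ x ∈ T.support, x ∈ D' ↔ x ∈ D) :
    T.Settled I' D' := by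
  have aux (A B B' : Finset V) (h : ∀ x ∈ A, x ∈ B' ↔ x ∈ B) : B ∩ A = B' ∩ A := by
    ext x
    have := h x
    grind
  induction T with
  | leaf v =>
    have hv : v ∈ (leaf v).support := Finset.mem_singleton_self v
    exact fun hvD => (hI v hv).2 (h ((hD v hv).1 hvD))
  | union l r ihl ihr =>
    simp only [support, Finset.mem_union] at hI hD
    exact ⟨ihl h.1 (fun x hx => hI x (.inl hx)) fun x hx => hD x (.inl hx),
      ihr h.2 (fun x hx => hI x (.inr hx)) fun x hx => hD x (.inr hx)⟩
  | join l r ihl ihr =>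
    rw [Settled, aux _ _ _ hI] at h
    simp only [support, Finset.mem_union] at hI hD
    rw [aux l.support I I' fun x hx => hI x (.inl hx), aux r.support I I' fun x hx => hI x (.inr hx),
      aux l.support D D' fun x hx => hD x (.inl hx),
      aux r.support D D' fun x hx => hD x (.inr hx)] at h
    refine h.imp_right (Or.imp (fun h => ⟨h.1, h.2.1, ?_⟩) fun h => ⟨h.1, h.2.1, ?_⟩)
    · exact ihl h.2.2 (fun x hx => hI x (.inl hx)) fun x hx => hD x (.inl hx)
    · exact ihr h.2.2 (fun x hx => hI x (.inr hx)) fun x hx => hD x (.inr hx)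

theorem settled_of_inter_eq {T : Cotree V} (hT : T.Valid) {I : Finset V} (D : Finset V)
    (hI : I ∩ T.support = T.maxIndep) : T.Settled I D := by
  induction T with
  | leaf v =>
    exact fun _ => (Finset.mem_inter.1 (hI.symm ▸ Finset.mem_singleton_self v :
      v ∈ I ∩ (leaf v).support)).1
  | union l r ihl ihr =>
    obtain ⟨h1, h2⟩ := maxIndep_inter_union (disjoint_support hT.2.2) hI
    exact ⟨ihl hT.1 h1, ihr hT.2.1 h2⟩
  | join l r ihl ihr => exact Or.inl hI

theorem settled_empty {T : Cotree V} {I : Finset V} (hI : T.Indep I) : T.Settled I ∅ := by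
  induction T with
  | leaf v => exact fun h => absurd h (Finset.notMem_empty v)
  | union l r ihl ihr => exact ⟨ihl hI.of_union.1, ihr hI.of_union.2⟩
  | join l r ihl ihr =>
    rcases hI.inter_eq_empty with h | h
    · exact Or.inr (Or.inr ⟨h, Finset.empty_inter _, ihr hI.of_join.2⟩)
    · exact Or.inr (Or.inl ⟨h, Finset.empty_inter _, ihl hI.of_join.1⟩)

/-- At a join node that is not yet canonical, D avoids an empty side, so a settled vertex of the
canonical set forces that set into the other side. This prevents removed vertices from being added
again. -/
theorem Settled.mem_of_mem_maxIndep {T : Cotree V} {I D : Finset V} (h : T.Settled I D) {x : V}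
    (hx : x ∈ T.maxIndep) (hxD : x ∈ D) : x ∈ I := by
  induction T with
  | leaf v =>
    rw [maxIndep, Finset.mem_singleton] at hx
    exact hx ▸ h (hx ▸ hxD)
  | union l r ihl ihr => exact (Finset.mem_union.1 hx).elim (ihl h.1) (ihr h.2)
  | join l r ihl ihr =>
    rcases h with h | ⟨-, h, h'⟩ | ⟨-, h, h'⟩
    · exact Finset.inter_subset_left (h ▸ hx)
    · rw [maxIndep] at hx
      split_ifs at hx
      · exact ihl h' hx
      · exact absurd hxD (notMem_of_inter_eq_empty h (r.maxIndep_subset hx))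
    · rw [maxIndep] at hx
      split_ifs at hx
      · exact absurd hxD (notMem_of_inter_eq_empty h (l.maxIndep_subset hx))
      · exact ihr h' hx

/-- The set `I` may be changed inside `W`, to `A`, in a way that is compatible with the level `k`
and with the settled vertices `D`. -/
structure Improves (T : Cotree V) (k : ℤ) (I D W A : Finset V) : Prop where
  subset_support : W ⊆ T.support
  subset : A ⊆ W
  le_card : k ≤ ((I \ W) ∩ T.support).card
  indep : T.Indep (I \ W ∪ A)
  ne : I ∩ W ≠ A
  mem_of_mem : ∀ x ∈ A, x ∈ D → x ∈ I
  settled : T.Settled (I \ W ∪ A) (D ∪ W)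

theorem improves_support {T : Cotree V} (hT : T.Valid) {k : ℤ} (hk : k ≤ 0) {I D : Finset V}
    (hD : T.Settled I D) (h : I ∩ T.support ≠ T.maxIndep) :
    T.Improves k I D T.support T.maxIndep := by
  have e : (I \ T.support ∪ T.maxIndep) ∩ T.support = T.maxIndep := by
    have := T.maxIndep_subset
    ext x
    grind
  exact ⟨subset_rfl, T.maxIndep_subset, by omega, indep_maxIndep hT e, h,
    fun x hx hxD => hD.mem_of_mem_maxIndep hx hxD, settled_of_inter_eq hT _ e⟩

/-- Descend to a node of level at most 0 where terminality fails; W is its support and A its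
canonical set. Siblings passed on the way are disjoint from W, hence untouched. -/
theorem exists_improves {T : Cotree V} (hT : T.Valid) {k : ℤ} {I D : Finset V} (hI : T.Indep I)
    (hk : k ≤ (I ∩ T.support).card) (hD : T.Settled I D) (h : ¬ T.Terminal k I) :
    ∃ W A, T.Improves k I D W A := by
  have mem_iff {W A B : Finset V} (hAW : A ⊆ W) (hWB : Disjoint W B) :
      ∀ x ∈ B, x ∈ I \ W ∪ A ↔ x ∈ I := by
    intro x hx
    have := Finset.disjoint_right.1 hWB hx
    grind
  have mem_iff' {W B : Finset V} (hWB : Disjoint W B) : ∀ x ∈ B, x ∈ D ∪ W ↔ x ∈ D := by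
    intro x hx
    have := Finset.disjoint_right.1 hWB hx
    grind
  have aux (A B B' : Finset V) (h : ∀ x ∈ A, x ∈ B' ↔ x ∈ B) : B' ∩ A = B ∩ A := by
    ext x
    have := h x
    grind
  induction T generalizing k with
  | leaf v =>
    have hk0 : k ≤ 0 := by
      by_contra hk0
      exact h fun h => absurd h hk0
    exact ⟨_, _, improves_support hT hk0 hD fun e => h fun _ => e⟩
  | union l r ihl ihr =>
    rcases le_or_gt k 0 with hk0 | hk0
    · exact ⟨_, _, improves_support hT hk0 hD fun e => h (terminal_of_inter_eq hT k e)⟩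
    have hd := disjoint_support hT.2.2
    rw [support, card_inter_union hd] at hk
    push_cast at hk
    have h' : ¬ l.Terminal (k - (I ∩ r.support).card) I ∨
        ¬ r.Terminal (k - (I ∩ l.support).card) I := by
      by_contra! hc
      exact h ⟨fun h => absurd hk0 (not_lt.2 h), fun _ => hc⟩
    rcases h' with h' | h'
    · obtain ⟨W, A, hWA⟩ := ihl hT.1 hI.of_union.1 (by omega) hD.1 h'
      have hWr := hd.mono_left hWA.subset_support
      have hm := mem_iff hWA.subset hWr
      refine ⟨W, A, hWA.subset_support.trans Finset.subset_union_left, hWA.subset, ?_,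
        indep_union hWA.indep ?_, hWA.ne, hWA.mem_of_mem,
        hWA.settled, hD.2.congr hm (mem_iff' hWr)⟩
      · have := hWA.le_card
        have e : (I \ W) ∩ r.support = I ∩ r.support := by
          ext x
          have := hm x
          have hxW : x ∈ r.support → x ∉ W := fun h => Finset.disjoint_right.1 hWr h
          grind
        rw [support, card_inter_union hd, e]
        push_cast
        omega
      · intro x hx y hy ha
        have hm' := ha.mem
        exact hI.of_union.2 x ((hm x hm'.1).1 hx) y ((hm y hm'.2).1 hy) ha
    · obtain ⟨W, A, hWA⟩ := ihr hT.2.1 hI.of_union.2 (by omega) hD.2 h'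
      have hWl := hd.symm.mono_left hWA.subset_support
      have hm := mem_iff hWA.subset hWl
      refine ⟨W, A, hWA.subset_support.trans Finset.subset_union_right, hWA.subset, ?_,
        indep_union ?_ hWA.indep, hWA.ne, hWA.mem_of_mem,
        hD.1.congr hm (mem_iff' hWl), hWA.settled⟩
      · have := hWA.le_card
        have e : (I \ W) ∩ l.support = I ∩ l.support := by
          ext x
          have := hm x
          have hxW : x ∈ l.support → x ∉ W := fun h => Finset.disjoint_right.1 hWl h
          grind
        rw [support, card_inter_union hd, e]
        push_cast
        omega
      · intro x hx y hy ha
        have hm' := ha.mem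
        exact hI.of_union.1 x ((hm x hm'.1).1 hx) y ((hm y hm'.2).1 hy) ha
  | join l r ihl ihr =>
    rcases le_or_gt k 0 with hk0 | hk0
    · exact ⟨_, _, improves_support hT hk0 hD fun e => h (terminal_of_inter_eq hT k e)⟩
    have hd := disjoint_support hT.2.2
    rw [support, card_inter_union hd] at hk
    push_cast at hk
    have hne : ¬ (I ∩ l.support = ∅ ∧ I ∩ r.support = ∅) := by
      rintro ⟨h1, h2⟩
      rw [h1, h2, Finset.card_empty] at hk
      omega
    rcases hD with hD | ⟨h1, h2, h3⟩ | ⟨h1, h2, h3⟩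
    · exact absurd (terminal_of_inter_eq hT k hD) h
    · rw [h1, Finset.card_empty] at hk
      obtain ⟨W, A, hWA⟩ := ihl hT.1 hI.of_join.1 (by omega) h3 fun h' =>
        h ⟨fun h => absurd hk0 (not_lt.2 h), fun _ => Or.inl ⟨h1, h'⟩⟩
      have hWr := hd.mono_left hWA.subset_support
      have e := (aux _ _ _ (mem_iff hWA.subset hWr)).trans h1
      refine ⟨W, A, hWA.subset_support.trans Finset.subset_union_left, hWA.subset,
        hWA.le_card.trans ?_, indep_join_left e hWA.indep, hWA.ne, hWA.mem_of_mem,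
        Or.inr (Or.inl ⟨e, (aux _ _ _ (mem_iff' hWr)).trans h2, hWA.settled⟩)⟩
      exact_mod_cast Finset.card_le_card
        (Finset.inter_subset_inter subset_rfl Finset.subset_union_left)
    · rw [h1, Finset.card_empty] at hk
      obtain ⟨W, A, hWA⟩ := ihr hT.2.1 hI.of_join.2 (by omega) h3 fun h' =>
        h ⟨fun h => absurd hk0 (not_lt.2 h), fun _ => Or.inr ⟨h1, h'⟩⟩
      have hWl := hd.symm.mono_left hWA.subset_support
      have e := (aux _ _ _ (mem_iff hWA.subset hWl)).trans h1
      refine ⟨W, A, hWA.subset_support.trans Finset.subset_union_right, hWA.subset,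
        hWA.le_card.trans ?_, indep_join_right e hWA.indep, hWA.ne, hWA.mem_of_mem,
        Or.inr (Or.inr ⟨e, (aux _ _ _ (mem_iff' hWl)).trans h2, hWA.settled⟩)⟩
      exact_mod_cast Finset.card_le_card
        (Finset.inter_subset_inter subset_rfl Finset.subset_union_right)

end Cotree

/-! ### Walks by token addition and removal -/

section Reconfiguration

open SimpleGraph

variable {V : Type*} [DecidableEq V]

/-- The token addition and removal graph: its edges join independent sets with at least `k`
elements that differ in exactly one vertex. -/
def tokenAddRemGraph (G : SimpleGraph V) (k : ℤ) : SimpleGraph (Finset V) where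
  Adj S S' := (G.IsIndepSet (S : Set V) ∧ k ≤ S.card) ∧ (G.IsIndepSet (S' : Set V) ∧ k ≤ S'.card) ∧
    ∃ x, (x ∉ S ∧ S' = insert x S) ∨ (x ∉ S' ∧ S = insert x S')
  symm := ⟨fun _ _ ⟨h, h', x, hx⟩ => ⟨h', h, x, hx.symm⟩⟩
  loopless := ⟨fun S ⟨_, _, x, hx⟩ => by
    rcases hx with ⟨h, h'⟩ | ⟨h, h'⟩ <;> exact h (h' ▸ Finset.mem_insert_self x S)⟩

theorem exists_walk_union {G : SimpleGraph V} {k : ℤ} {S R : Finset V} (hd : Disjoint S R)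
    (hi : G.IsIndepSet ((S ∪ R : Finset V) : Set V)) (hk : k ≤ S.card) :
    ∃ p : (tokenAddRemGraph G k).Walk S (S ∪ R), p.length = R.card := by
  induction R using Finset.induction_on with
  | empty => exact ⟨Walk.nil.copy rfl (by simp), by simp⟩
  | insert x R hx ih =>
    rw [Finset.disjoint_insert_right] at hd
    have hsub : S ∪ R ⊆ S ∪ insert x R :=
      Finset.union_subset_union_right (Finset.subset_insert x R)
    have hi' := Set.Pairwise.mono (Finset.coe_subset.2 hsub) hi
    obtain ⟨p, hp⟩ := ih hd.2 hi'
    have hc : S.card ≤ (S ∪ R).card := Finset.card_le_card Finset.subset_union_left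
    have hc' := Finset.card_le_card hsub
    have ha : (tokenAddRemGraph G k).Adj (S ∪ R) (S ∪ insert x R) :=
      ⟨⟨hi', by omega⟩, ⟨hi, by omega⟩, x, Or.inl ⟨by simp [hd.1, hx], by
        rw [Finset.union_insert]⟩⟩
    exact ⟨p.concat ha, by rw [Walk.length_concat, hp, Finset.card_insert_of_notMem hx]⟩

theorem exists_walk_of_le_card_inter {G : SimpleGraph V} {k : ℤ} {S S' : Finset V}
    (hS : G.IsIndepSet (S : Set V)) (hS' : G.IsIndepSet (S' : Set V))
    (hk : k ≤ (S ∩ S').card) :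
    ∃ p : (tokenAddRemGraph G k).Walk S S', p.length = (S \ S').card + (S' \ S).card := by
  have e : (S ∩ S') ∪ (S \ S') = S := by ext; grind
  have e' : (S ∩ S') ∪ (S' \ S) = S' := by ext; grind
  obtain ⟨p, hp⟩ := exists_walk_union (G := G) (k := k) (S := S ∩ S') (R := S \ S')
    (by rw [Finset.disjoint_left]; grind) (by rwa [e]) hk
  obtain ⟨q, hq⟩ := exists_walk_union (G := G) (k := k) (S := S ∩ S') (R := S' \ S)
    (by rw [Finset.disjoint_left]; grind) (by rwa [e']) hk
  exact ⟨(p.reverse.append q).copy e e', by simp [hp, hq]⟩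

namespace Cotree

theorem IsCotreeFor.inter_support {T : Cotree V} {G : SimpleGraph V}
    (h : T.IsCotreeFor G) (I : Finset V) : I ∩ T.support = I := by
  refine Finset.inter_eq_left.2 fun x _ => ?_
  rw [← mem_verts, h.2.1]
  trivial

/-- The potential charges one for each token (its removal) and two for each vertex outside I ∪ D
(its addition and removal). Vertices of D outside I are free, since they are never added again. -/
theorem exists_walk_terminal [Fintype V] {T : Cotree V} {G : SimpleGraph V}
    (h : T.IsCotreeFor G) {k : ℤ} (n : ℕ) {I D : Finset V} (hI : G.IsIndepSet (I : Set V))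
    (hk : k ≤ I.card) (hD : T.Settled I D)
    (hn : I.card + 2 * ((I ∪ D)ᶜ : Finset V).card ≤ n) :
    ∃ M, T.Terminal k M ∧ G.IsIndepSet (M : Set V) ∧ k ≤ M.card ∧
      ∃ p : (tokenAddRemGraph G k).Walk I M, p.length ≤ n := by
  induction n using Nat.strong_induction_on generalizing I D with
  | _ n ih =>
  by_cases hT : T.Terminal k I
  · exact ⟨I, hT, hI, hk, Walk.nil, Nat.zero_le _⟩
  obtain ⟨W, A, hWA⟩ := exists_improves h.1 ((h.indep_iff I).2 hI)
    (by rwa [h.inter_support]) hD hT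
  set I' := I \ W ∪ A with hI'
  have hI'i := (h.indep_iff I').1 hWA.indep
  have hAW := hWA.subset
  have hkI : k ≤ (I ∩ I').card := by
    refine hWA.le_card.trans ?_
    rw [h.inter_support]
    exact_mod_cast Finset.card_le_card (by intro x; grind)
  obtain ⟨p, hp⟩ := exists_walk_of_le_card_inter hI hI'i hkI
  have hne : I ≠ I' := by
    intro e
    apply hWA.ne
    ext x
    have := Finset.ext_iff.1 e x
    grind
  have hpos : 0 < p.length := by
    rw [Nat.pos_iff_ne_zero]
    exact fun h0 => hne (Walk.eq_of_length_eq_zero h0)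
  have h1 : (I \ I').card + (I ∩ I').card = I.card := Finset.card_sdiff_add_card_inter I I'
  have h2 : (I' \ I).card + (I ∩ I').card = I'.card := by
    rw [Finset.inter_comm]; exact Finset.card_sdiff_add_card_inter I' I
  -- Each added vertex leaves the complement; its charge of two pays for the addition and for the
  -- token it becomes.
  have h3 : (I' \ I).card + ((I' ∪ (D ∪ W))ᶜ : Finset V).card ≤ ((I ∪ D)ᶜ : Finset V).card := by
    rw [← Finset.card_union_of_disjoint (by rw [Finset.disjoint_left]; intro x; simp; grind)]
    refine Finset.card_le_card fun x => ?_
    have := hWA.mem_of_mem x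
    simp only [Finset.mem_union, Finset.mem_compl, Finset.mem_sdiff, hI']
    grind
  obtain ⟨M, hM, hMi, hMk, q, hq⟩ := ih (n - p.length) (by omega) hI'i
    (hkI.trans (by exact_mod_cast Finset.card_le_card Finset.inter_subset_right)) hWA.settled
    (by omega)
  exact ⟨M, hM, hMi, hMk, p.append q, by rw [Walk.length_append]; omega⟩

theorem confined_of_walk {T : Cotree V} {G : SimpleGraph V} (h : T.IsCotreeFor G) {k : ℤ}
    {M L N : Finset V} (hM : T.Terminal k M) (hkM : k ≤ M.card)
    (p : (tokenAddRemGraph G k).Walk L N) (hL : T.Confined k M L) : T.Confined k M N := by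
  induction p with
  | nil => exact hL
  | cons ha p ih =>
    obtain ⟨⟨h1, h2⟩, ⟨h3, h4⟩, x, hx⟩ := ha
    refine ih (hL.step h.1 hM ?_ ((h.indep_iff _).2 h1) ((h.indep_iff _).2 h3) ?_ ?_ (x := x) ?_)
    · rwa [h.inter_support]
    · rwa [h.inter_support]
    · rwa [h.inter_support]
    · intro y hy
      rcases hx with ⟨-, rfl⟩ | ⟨-, rfl⟩ <;> simp [hy]

theorem exists_tokenAddRemGraph_walk [Fintype V] {T : Cotree V} {G : SimpleGraph V}
    (h : T.IsCotreeFor G) {k : ℤ} {I J : Finset V} (hI : G.IsIndepSet (I : Set V))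
    (hkI : k ≤ I.card) (hJ : G.IsIndepSet (J : Set V)) (hkJ : k ≤ J.card)
    (hIJ : (tokenAddRemGraph G k).Reachable I J) :
    ∃ p : (tokenAddRemGraph G k).Walk I J, p.length + I.card + J.card ≤ 4 * Fintype.card V := by
  -- With D empty the budget is |I| + 2(n - |I|) = 2n - |I|.
  obtain ⟨M, hM, hMi, hMk, p, hp⟩ := exists_walk_terminal h _ hI hkI
    (settled_empty ((h.indep_iff I).2 hI)) le_rfl
  obtain ⟨N, hN, hNi, hNk, q, hq⟩ := exists_walk_terminal h _ hJ hkJ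
    (settled_empty ((h.indep_iff J).2 hJ)) le_rfl
  obtain ⟨w⟩ := (p.reachable.symm.trans hIJ).trans q.reachable
  have e := hM.inter_eq_inter h.1 hN (by rwa [h.inter_support]) (by rwa [h.inter_support])
    ((h.indep_iff M).2 hMi) ((h.indep_iff N).2 hNi)
    (confined_of_walk h hM hMk w hM.confined_self)
    (confined_of_walk h hN hNk w.reverse hN.confined_self)
  rw [h.inter_support, h.inter_support] at e
  subst e
  refine ⟨p.append q.reverse, ?_⟩
  rw [Walk.length_append, Walk.length_reverse]
  rw [Finset.union_empty] at hp hq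
  have := Finset.card_add_card_compl I
  have := Finset.card_add_card_compl J
  omega

end Cotree

/-! ### Translation to and from token jumping -/

theorem reachable_of_tokenJumpingGraph_reachable {G : SimpleGraph V} {k : ℤ}
    {I J : {I : Finset V // G.IsIndepSet (I : Set V) ∧ (I.card : ℤ) = k}}
    (h : (tokenJumpingGraph G k).Reachable I J) :
    (tokenAddRemGraph G (k - 1)).Reachable I.1 J.1 := by
  obtain ⟨p⟩ := h
  induction p with
  | nil => rfl
  | @cons I J K ha p ih =>
    refine Reachable.trans ?_ ih
    obtain ⟨-, u, hu, v, hv, huv⟩ := ha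
    have aux (I : {I : Finset V // G.IsIndepSet (I : Set V) ∧ (I.card : ℤ) = k}) (u : V)
        (hu : u ∈ I.1) : (tokenAddRemGraph G (k - 1)).Adj I.1 (I.1 \ {u}) := by
      have hc := Finset.card_sdiff_add_card_eq_card (Finset.singleton_subset_iff.2 hu)
      rw [Finset.card_singleton] at hc
      have := I.2.2
      refine ⟨⟨I.2.1, by omega⟩, ⟨Set.Pairwise.mono (by simp) I.2.1, by omega⟩, u, Or.inr ⟨by simp, ?_⟩⟩
      ext x
      by_cases hx : x = u <;> simp [hx, hu]
    exact (aux I u hu).reachable.trans (huv ▸ (aux J v hv).reachable.symm)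

/-- Reading the walk backwards from its end, a k-set A shadows S. A jump is made only when S moves
closer to size k, so the drop of ||S| - k| and the walk edge together pay its weight of two. -/
theorem exists_tokenJumpingGraph_walk_of_walk {G : SimpleGraph V} {k : ℤ}
    (I : {I : Finset V // G.IsIndepSet (I : Set V) ∧ (I.card : ℤ) = k}) {S S' : Finset V}
    (p : (tokenAddRemGraph G (k - 1)).Walk S S') (hS' : S' = I.1) :
    ∃ A : {I : Finset V // G.IsIndepSet (I : Set V) ∧ (I.card : ℤ) = k},
      ∃ q : (tokenJumpingGraph G k).Walk A I, 2 * q.length + |(S.card : ℤ) - k| ≤ p.length ∧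
        (A.1 ⊆ S ∨ (S ⊆ A.1 ∧ S.card + 1 = A.1.card)) := by
  induction p with
  | nil => exact ⟨I, Walk.nil, by simp [hS', I.2.2], Or.inl hS'.ge⟩
  | @cons S S₁ S' ha p ih =>
    obtain ⟨A, q, hq, hA⟩ := ih hS'
    have hAk := A.2.2
    rw [Walk.length_cons]
    obtain ⟨⟨hSi, hSk⟩, ⟨hS₁i, hS₁k⟩, x, ⟨hx, rfl⟩ | ⟨hx, rfl⟩⟩ := ha
    · have hc := Finset.card_insert_of_notMem hx
      have hA : A.1 ⊆ insert x S := by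
        refine hA.resolve_right fun h => ?_
        omega
      by_cases hxA : x ∈ A.1
      · by_cases hAS : insert x S ⊆ A.1
        · have e := hA.antisymm hAS
          refine ⟨A, q, ?_, Or.inr ⟨(Finset.subset_insert x S).trans hAS, by rw [e, hc]⟩⟩
          rw [hc] at hq
          push_cast at hq ⊢
          grind
        -- Here S still has at least k elements, so the token on x can sit on a free vertex y of S
        -- instead.
        · obtain ⟨y, hy, hyA⟩ := Finset.not_subset.1 hAS
          have hsub : insert y (A.1 \ {x}) ⊆ S := by
            intro z hz
            have := @hA z
            grind
          have hyn : y ∉ A.1 \ {x} := fun h => hyA (Finset.mem_sdiff.1 h).1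
          have hcA := Finset.card_sdiff_add_card_eq_card (Finset.singleton_subset_iff.2 hxA)
          rw [Finset.card_singleton] at hcA
          have hcB := Finset.card_insert_of_notMem hyn
          have hle := Finset.card_le_card hsub
          have hadj : (tokenJumpingGraph G k).Adj ⟨insert y (A.1 \ {x}),
              Set.Pairwise.mono (Finset.coe_subset.2 hsub) hSi, by omega⟩ A := by
            refine ⟨fun e => hyA ?_, y, Finset.mem_insert_self y _, x, hxA, ?_⟩
            · rw [← e]
              exact Finset.mem_insert_self y _
            · ext z
              grind
          refine ⟨_, Walk.cons hadj q, ?_, Or.inl hsub⟩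
          rw [Walk.length_cons]
          rw [hc] at hq
          push_cast at hq ⊢
          grind
      · have hsub : A.1 ⊆ S := (Finset.subset_insert_iff_of_notMem hxA).1 hA
        refine ⟨A, q, ?_, Or.inl hsub⟩
        have := Finset.card_le_card hsub
        rw [hc] at hq
        push_cast at hq ⊢
        grind
    · have hc := Finset.card_insert_of_notMem hx
      rcases hA with hA | ⟨hA, hAc⟩
      · refine ⟨A, q, ?_, Or.inl (hA.trans (Finset.subset_insert x _))⟩
        rw [hc]
        push_cast
        grind
      · by_cases e : insert x S₁ = A.1
        · refine ⟨A, q, ?_, Or.inl e.ge⟩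
          rw [hc]
          push_cast
          grind
        -- Since |S₁| = k - 1, A is S₁ plus one vertex u, and x jumps to u.
        · obtain ⟨u, hu⟩ := Finset.card_eq_one.1
            (show (A.1 \ S₁).card = 1 by rw [Finset.card_sdiff_of_subset hA]; omega)
          have hadj : (tokenJumpingGraph G k).Adj ⟨insert x S₁, hSi, by omega⟩ A := by
            refine ⟨fun h => e (congrArg Subtype.val h), x, Finset.mem_insert_self x _, u, ?_, ?_⟩
            · exact (Finset.mem_sdiff.1 (hu ▸ Finset.mem_singleton_self u)).1
            · ext z
              have := Finset.ext_iff.1 hu z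
              have := @hA z
              grind
          refine ⟨_, Walk.cons hadj q, ?_, Or.inl subset_rfl⟩
          rw [Walk.length_cons]
          rw [hc]
          push_cast
          grind

end Reconfiguration

/-! ### Diameter of a component -/

theorem SimpleGraph.ConnectedComponent.edist_toSimpleGraph_le {V : Type*} {G : SimpleGraph V}
    (C : G.ConnectedComponent) {u v : V} (p : G.Walk u v) (hu : u ∈ C) (hv : v ∈ C) :
    C.toSimpleGraph.edist ⟨u, hu⟩ ⟨v, hv⟩ ≤ p.length := by
  suffices h : ∃ q : C.toSimpleGraph.Walk ⟨u, hu⟩ ⟨v, hv⟩, q.length = p.length by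
    obtain ⟨q, hq⟩ := h
    exact hq ▸ q.edist_le
  induction p with
  | nil => exact ⟨Walk.nil, rfl⟩
  | @cons u w v ha p ih =>
    have hw : w ∈ C := C.mem_supp_of_adj_mem_supp hu ha
    obtain ⟨q, hq⟩ := ih hw hv
    exact ⟨Walk.cons ((C.toSimpleGraph_adj hu hw).2 ha) q, by rw [Walk.length_cons,
      Walk.length_cons, hq]⟩

theorem mainTheorem8 {V : Type*} [Fintype V] [DecidableEq V] (G : SimpleGraph V)
    (hG : IsCograph G) (k : ℤ) (C : (tokenJumpingGraph G k).ConnectedComponent) :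
    C.toSimpleGraph.ediam ≠ ⊤ ∧
      (C.toSimpleGraph.diam : ℤ) ≤ 2 * (Fintype.card V : ℤ) - k := by
  obtain ⟨T, hT⟩ := hG
  -- A component is nonempty, so 2n - k is nonnegative and `toNat` loses nothing.
  have hk : k ≤ Fintype.card V := by
    obtain ⟨I, -⟩ := C.nonempty_supp
    rw [← I.2.2]
    exact_mod_cast Finset.card_le_univ I.1
  have key : C.toSimpleGraph.ediam ≤ ((2 * (Fintype.card V : ℤ) - k).toNat : ℕ) := by
    refine SimpleGraph.ediam_le_of_edist_le ?_
    rintro ⟨I, hI⟩ ⟨J, hJ⟩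
    have hIk := I.2.2
    have hJk := J.2.2
    obtain ⟨p, hp⟩ := Cotree.exists_tokenAddRemGraph_walk hT I.2.1 (by omega) J.2.1 (by omega)
      (reachable_of_tokenJumpingGraph_reachable (C.reachable_of_mem_supp hI hJ))
    obtain ⟨A, q, hq, hA⟩ := exists_tokenJumpingGraph_walk_of_walk J p rfl
    have hAk := A.2.2
    have e : A = I := by
      refine Subtype.ext (Finset.eq_of_subset_of_card_le (hA.resolve_right ?_) ?_) <;> omega
    subst e
    refine (C.edist_toSimpleGraph_le q hI hJ).trans ?_
    rw [hAk] at hq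
    simp only [sub_self, abs_zero] at hq
    exact_mod_cast (by omega : q.length ≤ (2 * (Fintype.card V : ℤ) - k).toNat)
  have htop := (key.trans_lt (ENat.natCast_lt_top _)).ne
  refine ⟨htop, ?_⟩
  have h : C.toSimpleGraph.diam ≤ (2 * (Fintype.card V : ℤ) - k).toNat :=
    ENat.toNat_le_of_le_natCast key
  omega
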